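/- Let $|\cdot|$ be a norm on $\mathbb{R}$ and let $\alpha\in\mathbb{R}$ be such that $\sum_{y\in\mathbb{Z}\setminus\{0\}}|y|^{\alpha}<\infty$. Consider the ferromagnetic Ising model on $\mathbb{Z}$ without magnetic field and with coupling constants $J_{i,j}=J_{j-i}$, $J_y=|y|^{\alpha}e^{-|y|}$ for $y\neq 0$: for a finite set $\Lambda\subset\mathbb{Z}$, let $\langle\cdot\rangle_{\Lambda,\beta}$ be the expectation under the probability measure on $\{-1,1\}^{\Lambda}$ proportional to $\exp\bigl(\beta\sum_{\{i,j\}\subset\Lambda}J_{j-i}\,\sigma_i\sigma_j\bigr)$, where each unordered pair of distinct sites is counted once, and let $\langle\sigma_0\sigma_x\rangle_{\beta}=\lim_{\Lambda\uparrow\mathbb{Z}}\langle\sigma_0\sigma_x\rangle_{\Lambda,\beta}$ be the infinite-volume pair correlation. Then there is $\beta_0>0$ such that, for every $\beta\in(0,\beta_0)$, this limit exists for all $x\in\mathbb{Z}$, and there is a constant $c_\beta>0$ such that, for all $x\in\mathbb{Z}\setminus\{0\}$, $$c_\beta^{-1}\,|x|^{\alpha}e^{-|x|}\;\le\;\langle\sigma_0\sigma_x\rangle_{\beta}\;\le\;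 c_\beta\,|x|^{\alpha}e^{-|x|}.$$ In particular, the pair correlation decays like the coupling itself, and the (one-dimensional) Ornstein–Zernike asymptotics fail: for every $\beta\in(0,\beta_0)$ and every direction $s\in\{1,-1\}$ there are no $A>0$ and $\nu>0$ such that $\langle\sigma_0\sigma_{ns}\rangle_{\beta}=A\,e^{-\nu n}(1+\mathsf{o}(1))$ as $n\to\infty$. -/

import Mathlib

open scoped Topology

noncomputable section

/-- `J_y = |y|^α e^{-|y|}`, where `|·|` is the norm on `ℝ` given by `p`. (The value at `y = 0` is
never used: the Hamiltonian only involves pairs of distinct sites.) -/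
def expCoupling (p : Seminorm ℝ ℝ) (α : ℝ) (y : ℤ) : ℝ :=
  (p (y : ℝ)) ^ α * Real.exp (-p (y : ℝ))

namespace Ising

/-- Spin configurations in the finite volume `Λ ⊂ ℤ`; a spin is an element of `ℤˣ = {1, -1}`. -/
abbrev Config (Λ : Finset ℤ) : Type := Λ → ℤˣ

/-- The value `±1` of the spin at the site `i`, as a real number. -/
def spin {Λ : Finset ℤ} (i : Λ) (σ : Config Λ) : ℝ := ((σ i : ℤ) : ℝ)

/-- The Hamiltonian in `Λ` without magnetic field and with free boundary condition,
`H_Λ(σ) = - ∑_{{i,j} ⊂ Λ} J_{j-i} σ_i σ_j`, each unordered pair `{i, j}` being counted once. -/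
def hamiltonian (J : ℤ → ℝ) (Λ : Finset ℤ) (σ : Config Λ) : ℝ :=
  -∑ e : Λ × Λ with e.1 < e.2, J ((e.2 : ℤ) - (e.1 : ℤ)) * (spin e.1 σ * spin e.2 σ)

/-- The Boltzmann weight `e^{-β H_Λ(σ)}`. -/
def weight (J : ℤ → ℝ) (β : ℝ) (Λ : Finset ℤ) (σ : Config Λ) : ℝ :=
  Real.exp (-β * hamiltonian J Λ σ)

/-- The partition function in `Λ`. -/
def partitionFunction (J : ℤ → ℝ) (β : ℝ) (Λ : Finset ℤ) : ℝ :=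
  ∑ σ : Config Λ, weight J β Λ σ

/-- The expectation of `f` under the finite-volume Gibbs measure in `Λ`. -/
def expectation (J : ℤ → ℝ) (β : ℝ) (Λ : Finset ℤ) (f : Config Λ → ℝ) : ℝ :=
  (∑ σ : Config Λ, f σ * weight J β Λ σ) / partitionFunction J β Λ

/-- The finite-volume pair correlation `⟨σ_i σ_j⟩_{Λ,β}`, for `i, j ∈ Λ` (and `0` otherwise). -/
def finiteCorrelation (J : ℤ → ℝ) (β : ℝ) (Λ : Finset ℤ) (i j : ℤ) : ℝ :=
  if h : i ∈ Λ ∧ j ∈ Λ then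
    expectation J β Λ (fun σ => spin ⟨i, h.1⟩ σ * spin ⟨j, h.2⟩ σ)
  else 0

/-- The infinite-volume pair correlation `⟨σ_0 σ_x⟩_β`: the limit of the finite-volume ones as
`Λ ↑ ℤ` (along the directed set of all finite subsets of `ℤ`). -/
def pairCorrelation (J : ℤ → ℝ) (β : ℝ) (x : ℤ) : ℝ :=
  Filter.limUnder Filter.atTop (fun Λ : Finset ℤ => finiteCorrelation J β Λ 0 x)

end Ising

/-- Ornstein–Zernike asymptotics of `G : ℤ → ℝ` in the direction `s ∈ {1, -1}`:
`G(ns) = A n^{-(d-1)/2} e^{-ν n} (1 + o(1))` as `n → ∞`, for some `A, ν > 0`. Here `d = 1`, so that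
the power of `n` is equal to `1`. -/
def HasOrnsteinZernikeAsymptotics (G : ℤ → ℝ) (s : ℤˣ) : Prop :=
  ∃ A : ℝ, 0 < A ∧ ∃ ν : ℝ, 0 < ν ∧
    Asymptotics.IsEquivalent Filter.atTop (fun n : ℕ => G ((s : ℤ) * (n : ℤ)))
      (fun n : ℕ => A * Real.exp (-ν * (n : ℝ)))

end

/-!
Spin products are characters of the finite group of configurations, and Griffiths' inequalities
hold for weights `exp (∑ k, K k * c k σ)` with characters `c k` and couplings `K k ≥ 0` on any
finite group. They give the infinite-volume limit and `⟨σ_i σ_j⟩ ≥ tanh (β J (j - i))`.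

For the upper bound, a model in which `i` interacts with no other site satisfies `⟨σ_i σ_j⟩ = 0`,
by flipping the spin at `i`. Restoring the interactions of `i` one at a time gives
`⟨σ_i σ_j⟩ ≤ ∑ y ≠ i, β J (y - i) ⟨σ_y σ_j⟩`.
Since the exponential factor of `J` is supermultiplicative and its power factor is decreasing and
summable, the convolution of `J` with itself is at most `C J`, so the best constant `M` in
`⟨σ_i σ_j⟩ ≤ M J (j - i)` satisfies `M ≤ β (1 + C M)`, which bounds it uniformly in the volume once
`β C < 1`.

Summability also forces `α < 0`, so `n ^ α * exp (-n |1|)` is comparable to no pure exponential.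
-/

namespace Ising

open Finset

section Tanh

lemma tanh_nonneg {a : ℝ} (ha : 0 ≤ a) : 0 ≤ Real.tanh a := by
  rw [Real.tanh_eq_sinh_div_cosh]
  exact div_nonneg (Real.sinh_nonneg_iff.2 ha) (Real.cosh_pos a).le

lemma tanh_le_self {a : ℝ} (ha : 0 ≤ a) : Real.tanh a ≤ a := by
  rw [Real.tanh_eq_sinh_div_cosh, div_le_iff₀ (Real.cosh_pos a), mul_comm]
  have hderiv : ∀ x ∈ interior (Set.Icc 0 a), deriv Real.sinh x ≤ Real.cosh a := fun x hx => by
    rw [Real.deriv_sinh, Real.cosh_le_cosh, abs_of_nonneg (interior_subset hx).1, abs_of_nonneg ha]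
    exact (interior_subset hx).2
  simpa using (convex_Icc 0 a).image_sub_le_mul_sub_of_deriv_le Real.continuous_sinh.continuousOn
    Real.differentiable_sinh.differentiableOn hderiv 0 ⟨le_rfl, ha⟩ a ⟨ha, le_rfl⟩ ha

lemma div_cosh_le_tanh {a b : ℝ} (ha : 0 ≤ a) (hab : a ≤ b) : a / Real.cosh b ≤ Real.tanh a := by
  rw [Real.tanh_eq_sinh_div_cosh]
  refine div_le_div₀ (Real.sinh_nonneg_iff.2 ha) (Real.self_le_sinh_iff.2 ha) (Real.cosh_pos a) ?_
  rwa [Real.cosh_le_cosh, abs_of_nonneg ha, abs_of_nonneg (ha.trans hab)]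

end Tanh

section Characters

variable {G : Type*} [Group G]

lemma character_eq_one_or_neg_one [Finite G] (χ : G →* ℝ) (σ : G) : χ σ = 1 ∨ χ σ = -1 := by
  have h : ‖χ σ‖ = 1 := (χ.isOfFinOrder (isOfFinOrder_of_finite σ)).norm_eq_one
  rwa [Real.norm_eq_abs, abs_eq zero_le_one] at h

lemma character_le_one [Finite G] (χ : G →* ℝ) (σ : G) : χ σ ≤ 1 := by
  rcases character_eq_one_or_neg_one χ σ with h | h <;> norm_num [h]

lemma neg_one_le_character [Finite G] (χ : G →* ℝ) (σ : G) : -1 ≤ χ σ := by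
  rcases character_eq_one_or_neg_one χ σ with h | h <;> norm_num [h]

lemma character_mul_self [Finite G] (χ : G →* ℝ) : χ * χ = 1 := by
  ext σ
  rcases character_eq_one_or_neg_one χ σ with h | h <;> simp [h]

lemma exp_mul_character [Finite G] (a : ℝ) (χ : G →* ℝ) (σ : G) :
    Real.exp (a * χ σ) = Real.cosh a + Real.sinh a * χ σ := by
  rcases character_eq_one_or_neg_one χ σ with h | h
  · simp [h, Real.cosh_add_sinh]
  · simp [h, ← Real.cosh_sub_sinh, sub_eq_add_neg]

lemma sum_character_nonneg [Fintype G] (χ : G →* ℝ) : 0 ≤ ∑ σ, χ σ := by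
  classical
  rw [sum_hom_units]
  split_ifs <;> positivity

lemma sum_character_mul_prod_nonneg [Fintype G] {ι : Type*} (c : ι → G →* ℝ) {a b : ι → ℝ}
    (ha : 0 ≤ a) (hb : 0 ≤ b) (s : Finset ι) (χ : G →* ℝ) :
    0 ≤ ∑ σ, χ σ * ∏ k ∈ s, (a k + b k * c k σ) := by
  classical
  induction s using Finset.induction_on generalizing χ with
  | empty => simpa using sum_character_nonneg χ
  | insert k s hk ih =>
    calc 0 ≤ a k * ∑ σ, χ σ * ∏ l ∈ s, (a l + b l * c l σ) +
          b k * ∑ σ, (χ * c k) σ * ∏ l ∈ s, (a l + b l * c l σ) :=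
        add_nonneg (mul_nonneg (ha k) (ih χ)) (mul_nonneg (hb k) (ih (χ * c k)))
      _ = ∑ σ, χ σ * ∏ l ∈ insert k s, (a l + b l * c l σ) := by
        rw [mul_sum, mul_sum, ← sum_add_distrib]
        refine sum_congr rfl fun σ _ => ?_
        rw [prod_insert hk, MonoidHom.mul_apply]
        ring

end Characters

section CharacterModel

variable {G H ι κ : Type*} [Group G] [Group H] [Fintype ι] [Fintype κ]

/-- The Boltzmann weight of a generalized Ising model: its configurations form a group `G` and its
interactions are characters `c k : G →* ℝ` with couplings `K k`. If `G` is finite, then characters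
only take the values `1` and `-1`. The Ising model in the volume `Λ` is the case
`G = Λ → {1, -1}`, the interactions being the products of two spins. -/
noncomputable def boltzmann (c : ι → G →* ℝ) (K : ι → ℝ) (σ : G) : ℝ :=
  Real.exp (∑ k, K k * c k σ)

lemma boltzmann_pos (c : ι → G →* ℝ) (K : ι → ℝ) (σ : G) : 0 < boltzmann c K σ :=
  Real.exp_pos _

lemma boltzmann_mul_boltzmann_mul (c : ι → G →* ℝ) (K L : ι → ℝ) (σ τ : G) :
    boltzmann c L σ * boltzmann c K (σ * τ) = boltzmann c (fun k => L k + K k * c k τ) σ := by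
  rw [boltzmann, boltzmann, boltzmann, ← Real.exp_add, ← sum_add_distrib]
  refine congrArg Real.exp (sum_congr rfl fun k _ => ?_)
  rw [map_mul]
  ring

lemma boltzmann_eq_exp_mul_update [DecidableEq ι] (c : ι → G →* ℝ) (K : ι → ℝ) (k : ι) (σ : G) :
    boltzmann c K σ = Real.exp (K k * c k σ) * boltzmann c (Function.update K k 0) σ := by
  have hsub : ∑ l, K l * c l σ - ∑ l, Function.update K k 0 l * c l σ = K k * c k σ := by
    rw [← sum_sub_distrib, Fintype.sum_eq_single k fun l hl => by simp [hl]]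
    simp
  rw [boltzmann, boltzmann, ← Real.exp_add, sub_eq_iff_eq_add.1 hsub]

lemma boltzmann_comp {e : ι → κ} (he : Function.Injective e) (c : κ → G →* ℝ) (K : κ → ℝ) :
    boltzmann (c ∘ e) (K ∘ e) = boltzmann c ((Set.range e).indicator K) := by
  ext σ
  refine congrArg Real.exp (Fintype.sum_of_injective e he _ _ (fun k hk => ?_) fun k => ?_)
  · rw [Set.indicator_of_notMem hk, zero_mul]
  · rw [Set.indicator_of_mem (Set.mem_range_self k), Function.comp_apply, Function.comp_apply]

variable [Fintype G] [Fintype H]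

/-- The expectation of the character `χ` in the generalized Ising model, before normalization by
the partition function `charSum c K 1`. -/
noncomputable def charSum (c : ι → G →* ℝ) (K : ι → ℝ) (χ : G →* ℝ) : ℝ :=
  ∑ σ, χ σ * boltzmann c K σ

/-- The expectation of the character `χ` in the generalized Ising model. -/
noncomputable def charMean (c : ι → G →* ℝ) (K : ι → ℝ) (χ : G →* ℝ) : ℝ :=
  charSum c K χ / charSum c K 1

lemma charSum_one (c : ι → G →* ℝ) (K : ι → ℝ) : charSum c K 1 = ∑ σ, boltzmann c K σ := by
  simp only [charSum, MonoidHom.one_apply, one_mul]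

lemma charSum_one_pos (c : ι → G →* ℝ) (K : ι → ℝ) : 0 < charSum c K 1 := by
  rw [charSum_one]
  exact sum_pos (fun σ _ => boltzmann_pos c K σ) univ_nonempty

lemma charSum_le_charSum_one (c : ι → G →* ℝ) (K : ι → ℝ) (χ : G →* ℝ) :
    charSum c K χ ≤ charSum c K 1 := by
  rw [charSum_one]
  exact sum_le_sum fun σ _ =>
    mul_le_of_le_one_left (boltzmann_pos c K σ).le (character_le_one χ σ)

lemma charMean_one (c : ι → G →* ℝ) (K : ι → ℝ) : charMean c K 1 = 1 :=
  div_self (charSum_one_pos c K).ne'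

lemma charMean_le_one (c : ι → G →* ℝ) (K : ι → ℝ) (χ : G →* ℝ) : charMean c K χ ≤ 1 :=
  (div_le_one (charSum_one_pos c K)).2 (charSum_le_charSum_one c K χ)

lemma charMean_eq_zero_of_symmetry (c : ι → G →* ℝ) (K : ι → ℝ) {χ : G →* ℝ} {g : G}
    (hg : ∀ k, K k = 0 ∨ c k g = 1) (hχ : χ g = -1) : charMean c K χ = 0 := by
  have hinv (σ : G) : boltzmann c K (g * σ) = boltzmann c K σ := by
    refine congrArg Real.exp (sum_congr rfl fun k _ => ?_)
    rcases hg k with h | h <;> simp [h]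
  have hneg : charSum c K χ = -charSum c K χ :=
    calc charSum c K χ = ∑ σ, χ (g * σ) * boltzmann c K (g * σ) :=
          (Equiv.sum_comp (Equiv.mulLeft g) _).symm
      _ = -charSum c K χ := by
          simp only [charSum, hinv, map_mul, hχ, neg_mul, one_mul, sum_neg_distrib]
  rw [charMean, self_eq_neg.1 hneg, zero_div]

lemma charMean_comp {e : ι → κ} (he : Function.Injective e) (c : κ → G →* ℝ) (K : κ → ℝ)
    (χ : G →* ℝ) :
    charMean (c ∘ e) (K ∘ e) χ = charMean c ((Set.range e).indicator K) χ := by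
  simp only [charMean, charSum, boltzmann_comp he]

lemma sum_comp_of_surjective [DecidableEq H] {φ : G →* H} (hφ : Function.Surjective φ)
    (F : H → ℝ) : ∑ g, F (φ g) = #{g | φ g = 1} * ∑ h, F h := by
  rw [← sum_fiberwise univ φ, mul_sum]
  refine sum_congr rfl fun h _ => ?_
  calc ∑ g with φ g = h, F (φ g) = ∑ g with φ g = h, F h :=
        sum_congr rfl fun g hg => by rw [(mem_filter.1 hg).2]
    _ = #{g | φ g = 1} * F h := by
        rw [sum_const, nsmul_eq_mul, MonoidHom.card_fiber_eq_of_mem_range φ (hφ h) (hφ 1)]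

lemma charMean_comp_of_surjective {φ : G →* H} (hφ : Function.Surjective φ) (c : ι → H →* ℝ)
    (K : ι → ℝ) (χ : H →* ℝ) :
    charMean (fun k => (c k).comp φ) K (χ.comp φ) = charMean c K χ := by
  classical
  have hsum (ψ : H →* ℝ) : charSum (fun k => (c k).comp φ) K (ψ.comp φ) =
      #{g | φ g = 1} * charSum c K ψ :=
    sum_comp_of_surjective hφ fun σ => ψ σ * boltzmann c K σ
  have hker : (#{g | φ g = 1} : ℝ) ≠ 0 :=
    Nat.cast_ne_zero.2 (card_ne_zero_of_mem (mem_filter.2 ⟨mem_univ 1, map_one φ⟩))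
  rw [charMean, charMean, ← MonoidHom.one_comp φ, hsum, hsum, mul_div_mul_left _ _ hker]

end CharacterModel

section Griffiths

variable {G ι : Type*} [Group G] [Fintype G] [Fintype ι] {c : ι → G →* ℝ} {K L : ι → ℝ}

lemma charSum_nonneg (hK : 0 ≤ K) (χ : G →* ℝ) : 0 ≤ charSum c K χ := by
  simpa only [charSum, boltzmann, Real.exp_sum, exp_mul_character] using
    sum_character_mul_prod_nonneg c (fun k => (Real.cosh_pos (K k)).le)
      (fun k => Real.sinh_nonneg_iff.2 (hK k)) univ χ

lemma charMean_nonneg (hK : 0 ≤ K) (χ : G →* ℝ) : 0 ≤ charMean c K χ :=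
  div_nonneg (charSum_nonneg hK χ) (charSum_one_pos c K).le

-- Ginibre's duplication trick: two copies `σ` and `σ * τ` of the model form, for fixed `τ`, one
-- model with the couplings `L + K * c τ`, which are nonnegative when `0 ≤ K ≤ L`.
lemma charSum_mul_sub_charSum_mul (c : ι → G →* ℝ) (K L : ι → ℝ) (χ : G →* ℝ) :
    charSum c L χ * charSum c K 1 - charSum c K χ * charSum c L 1 =
      ∑ τ, (1 - χ τ) * charSum c (fun k => L k + K k * c k τ) χ :=
  calc charSum c L χ * charSum c K 1 - charSum c K χ * charSum c L 1
      = ∑ σ, ∑ σ', (χ σ - χ σ') * (boltzmann c L σ * boltzmann c K σ') := by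
        rw [charSum_one, charSum_one, mul_comm (charSum c K χ), charSum, charSum, sum_mul_sum,
          sum_mul_sum, ← sum_sub_distrib]
        refine sum_congr rfl fun σ _ => ?_
        rw [← sum_sub_distrib]
        exact sum_congr rfl fun σ' _ => by ring
    _ = ∑ σ, ∑ τ, (χ σ - χ (σ * τ)) * (boltzmann c L σ * boltzmann c K (σ * τ)) :=
        sum_congr rfl fun σ _ => (Equiv.sum_comp (Equiv.mulLeft σ) _).symm
    _ = ∑ τ, (1 - χ τ) * charSum c (fun k => L k + K k * c k τ) χ := by
        rw [sum_comm]
        refine sum_congr rfl fun τ _ => ?_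
        rw [charSum, mul_sum]
        refine sum_congr rfl fun σ _ => ?_
        rw [boltzmann_mul_boltzmann_mul, map_mul]
        ring

lemma charMean_mono (hK : 0 ≤ K) (hKL : K ≤ L) (χ : G →* ℝ) :
    charMean c K χ ≤ charMean c L χ := by
  have hnonneg (τ : G) : 0 ≤ fun k => L k + K k * c k τ := fun k =>
    calc 0 ≤ L k + K k * (-1) := by linarith [hKL k]
      _ ≤ L k + K k * c k τ :=
        add_le_add_right (mul_le_mul_of_nonneg_left (neg_one_le_character _ _) (hK k)) _
  rw [charMean, charMean, div_le_div_iff₀ (charSum_one_pos c K) (charSum_one_pos c L),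
    ← sub_nonneg, charSum_mul_sub_charSum_mul]
  exact sum_nonneg fun τ _ =>
    mul_nonneg (sub_nonneg.2 (character_le_one χ τ)) (charSum_nonneg (hnonneg τ) χ)

lemma charMean_comp_le {κ : Type*} [Fintype κ] {e : κ → ι} (he : Function.Injective e)
    (hK : 0 ≤ K) (χ : G →* ℝ) : charMean (c ∘ e) (K ∘ e) χ ≤ charMean c K χ := by
  rw [charMean_comp he]
  exact charMean_mono (Set.indicator_nonneg fun k _ => hK k)
    (Set.indicator_le_self' fun k _ => hK k) χ

section Removal

variable [DecidableEq ι]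

lemma charSum_eq_update (c : ι → G →* ℝ) (K : ι → ℝ) (χ : G →* ℝ) (k : ι) :
    charSum c K χ = Real.cosh (K k) * charSum c (Function.update K k 0) χ +
      Real.sinh (K k) * charSum c (Function.update K k 0) (χ * c k) := by
  simp only [charSum, mul_sum, ← sum_add_distrib]
  refine sum_congr rfl fun σ _ => ?_
  rw [boltzmann_eq_exp_mul_update c K k, exp_mul_character, MonoidHom.mul_apply]
  ring

lemma charMean_eq_update (c : ι → G →* ℝ) (K : ι → ℝ) (χ : G →* ℝ) (k : ι) :
    charMean c K χ = (charMean c (Function.update K k 0) χ +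
        Real.tanh (K k) * charMean c (Function.update K k 0) (χ * c k)) /
      (1 + Real.tanh (K k) * charMean c (Function.update K k 0) (c k)) := by
  have hZ := charSum_one_pos c (Function.update K k 0)
  have hcosh := Real.cosh_pos (K k)
  have hdenom := charSum_one_pos c K
  rw [charSum_eq_update c K 1 k, one_mul] at hdenom
  rw [charMean, charSum_eq_update c K χ k, charSum_eq_update c K 1 k, one_mul, charMean, charMean,
    charMean, Real.tanh_eq_sinh_div_cosh, ← mul_div_mul_left _ (1 + _) (mul_pos hcosh hZ).ne']
  congr 1 <;> field_simp

lemma charMean_le_update (hK : 0 ≤ K) (χ : G →* ℝ) (k : ι) :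
    charMean c K χ ≤ charMean c (Function.update K k 0) χ +
      K k * charMean c (Function.update K k 0) (χ * c k) := by
  have h0 : 0 ≤ Function.update K k 0 := le_update_iff.2 ⟨le_rfl, fun l _ => hK l⟩
  have htanh := tanh_nonneg (hK k)
  rw [charMean_eq_update c K χ k]
  calc _ ≤ charMean c (Function.update K k 0) χ +
        Real.tanh (K k) * charMean c (Function.update K k 0) (χ * c k) :=
        div_le_self
          (add_nonneg (charMean_nonneg h0 χ) (mul_nonneg htanh (charMean_nonneg h0 _)))
          (le_add_of_nonneg_right (mul_nonneg htanh (charMean_nonneg h0 _)))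
    _ ≤ _ := by
        gcongr
        exacts [charMean_nonneg h0 _, tanh_le_self (hK k)]

lemma charMean_le_piecewise_add_sum (hK : 0 ≤ K) (χ : G →* ℝ) (s : Finset ι) :
    charMean c K χ ≤ charMean c (s.piecewise 0 K) χ + ∑ k ∈ s, K k * charMean c K (χ * c k) := by
  induction s using Finset.induction_on with
  | empty => simp
  | insert k s hk ih =>
    have hs : 0 ≤ s.piecewise (0 : ι → ℝ) K := le_piecewise_of_le_of_le s le_rfl hK
    have hsk : s.piecewise (0 : ι → ℝ) K k = K k := piecewise_eq_of_notMem s _ _ hk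
    have hstep := charMean_le_update (c := c) hs χ k
    have hmono : charMean c ((insert k s).piecewise 0 K) (χ * c k) ≤ charMean c K (χ * c k) :=
      charMean_mono (le_piecewise_of_le_of_le _ le_rfl hK) (piecewise_le_of_le_of_le _ hK le_rfl) _
    rw [hsk, show (0 : ℝ) = (0 : ι → ℝ) k from rfl, ← piecewise_insert] at hstep
    rw [sum_insert hk]
    linarith [mul_le_mul_of_nonneg_left hmono (hK k)]

end Removal

lemma tanh_le_charMean (hK : 0 ≤ K) (k : ι) : Real.tanh (K k) ≤ charMean c K (c k) := by
  classical
  have h0 : 0 ≤ Function.update K k 0 := le_update_iff.2 ⟨le_rfl, fun l _ => hK l⟩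
  have htanh := tanh_nonneg (hK k)
  have hm := charMean_nonneg (c := c) h0 (c k)
  have hsq := Real.tanh_sq_lt_one (K k)
  rw [charMean_eq_update c K (c k) k, character_mul_self, charMean_one, le_div_iff₀ (by positivity)]
  nlinarith

lemma charMean_le_sum_of_flip (hK : 0 ≤ K) {χ : G →* ℝ} {g : G} (hχ : χ g = -1) :
    charMean c K χ ≤ ∑ k with c k g = -1, K k * charMean c K (χ * c k) := by
  classical
  refine (charMean_le_piecewise_add_sum hK χ {k | c k g = -1}).trans_eq ?_
  rw [charMean_eq_zero_of_symmetry c _ (fun k => ?_) hχ, zero_add]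
  refine (character_eq_one_or_neg_one (c k) g).symm.imp_left fun hk => ?_
  rw [piecewise_eq_of_mem _ _ _ (mem_filter.2 ⟨mem_univ k, hk⟩), Pi.zero_apply]

end Griffiths

section FiniteVolume

variable {Λ : Finset ℤ}

/-- The spin at the site `i`, as a character of the group of configurations. -/
def spinChar (i : Λ) : Config Λ →* ℝ where
  toFun := spin i
  map_one' := by simp [spin]
  map_mul' := by simp [spin]

lemma spinChar_apply (i : Λ) (σ : Config Λ) : spinChar i σ = spin i σ := rfl

/-- The product of the spins of a pair of sites, as a character of the group of configurations. -/
noncomputable def bondChar (e : Λ × Λ) : Config Λ →* ℝ := spinChar e.1 * spinChar e.2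

/-- The coupling, including the inverse temperature `β`, of a pair of sites. It vanishes unless the
pair is increasing, so that each unordered pair is counted once. -/
noncomputable def bondCoupling (J : ℤ → ℝ) (β : ℝ) (Λ : Finset ℤ) (e : Λ × Λ) : ℝ :=
  if e.1 < e.2 then β * J (e.2 - e.1) else 0

lemma weight_eq_boltzmann (J : ℤ → ℝ) (β : ℝ) (σ : Config Λ) :
    weight J β Λ σ = boltzmann bondChar (bondCoupling J β Λ) σ := by
  rw [weight, hamiltonian, boltzmann, neg_mul_neg, mul_sum, sum_filter]
  refine congrArg Real.exp (sum_congr rfl fun e _ => ?_)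
  rw [bondCoupling, ite_mul, zero_mul, mul_assoc]
  rfl

lemma finiteCorrelation_eq_charMean (J : ℤ → ℝ) (β : ℝ) (i j : Λ) :
    finiteCorrelation J β Λ i j =
      charMean bondChar (bondCoupling J β Λ) (spinChar i * spinChar j) := by
  rw [finiteCorrelation, dif_pos ⟨i.2, j.2⟩, expectation, partitionFunction, charMean,
    charSum_one, charSum]
  simp only [weight_eq_boltzmann]
  rfl

lemma finiteCorrelation_self (J : ℤ → ℝ) (β : ℝ) {i : ℤ} (hi : i ∈ Λ) :
    finiteCorrelation J β Λ i i = 1 := by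
  rw [finiteCorrelation_eq_charMean J β ⟨i, hi⟩ ⟨i, hi⟩, character_mul_self, charMean_one]

lemma finiteCorrelation_le_one (J : ℤ → ℝ) (β : ℝ) (Λ : Finset ℤ) (i j : ℤ) :
    finiteCorrelation J β Λ i j ≤ 1 := by
  by_cases h : i ∈ Λ ∧ j ∈ Λ
  · exact (finiteCorrelation_eq_charMean J β ⟨i, h.1⟩ ⟨j, h.2⟩).trans_le (charMean_le_one _ _ _)
  · rw [finiteCorrelation, dif_neg h]
    exact zero_le_one

lemma bondChar_mulSingle_of_ne {i : Λ} {e : Λ × Λ} (h₁ : e.1 ≠ i) (h₂ : e.2 ≠ i) (u : ℤˣ) :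
    bondChar e (Pi.mulSingle i u) = 1 := by
  simp [bondChar, spinChar_apply, spin, h₁, h₂]

lemma spinChar_mul_spinChar_mulSingle {i j : Λ} (hij : i ≠ j) (u : ℤˣ) :
    (spinChar i * spinChar j) (Pi.mulSingle i u) = u := by
  simp [spinChar_apply, spin, hij.symm]

/-- The pair of the sites `i` and `y` in increasing order. -/
noncomputable def orderedBond (i y : Λ) : Λ × Λ := (min i y, max i y)

lemma orderedBond_injective (i : Λ) : Function.Injective (orderedBond i) := fun y z h =>
  eq_of_inf_eq_sup_eq (a := i)
    (by simpa only [inf_comm, orderedBond] using congrArg Prod.fst h)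
    (by simpa only [sup_comm, orderedBond] using congrArg Prod.snd h)

lemma bondChar_orderedBond (i y : Λ) : bondChar (orderedBond i y) = spinChar i * spinChar y := by
  rcases le_total i y with h | h <;> simp [bondChar, orderedBond, h, mul_comm]

lemma exists_orderedBond_eq {i : Λ} {e : Λ × Λ} (hlt : e.1 < e.2) (hi : e.1 = i ∨ e.2 = i) :
    ∃ y ≠ i, orderedBond i y = e := by
  obtain ⟨a, b⟩ := e
  rcases hi with rfl | rfl
  · exact ⟨b, hlt.ne', by simp [orderedBond, hlt.le]⟩
  · exact ⟨a, hlt.ne, by simp [orderedBond, hlt.le]⟩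

lemma sum_bondCoupling_mul_of_flip (J : ℤ → ℝ) (β : ℝ) (i : Λ) (F : Λ × Λ → ℝ) :
    ∑ e with bondChar e (Pi.mulSingle i (-1)) = -1, bondCoupling J β Λ e * F e =
      ∑ y ∈ univ.erase i, bondCoupling J β Λ (orderedBond i y) * F (orderedBond i y) := by
  refine (sum_of_injOn (orderedBond i) (orderedBond_injective i).injOn (fun y hy => ?_)
    (fun e he hne => ?_) fun _ _ => rfl).symm
  · have hiy : i ≠ y := (ne_of_mem_erase hy).symm
    simp [bondChar_orderedBond, spinChar_mul_spinChar_mulSingle hiy]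
  · by_cases hlt : e.1 < e.2
    · have hi : e.1 = i ∨ e.2 = i := by
        by_contra! h
        have := (bondChar_mulSingle_of_ne h.1 h.2 (-1)).symm.trans (mem_filter.1 he).2
        norm_num at this
      obtain ⟨y, hy, rfl⟩ := exists_orderedBond_eq hlt hi
      exact absurd (Set.mem_image_of_mem _ (mem_erase.2 ⟨hy, mem_univ y⟩)) hne
    · rw [bondCoupling, if_neg hlt, zero_mul]

end FiniteVolume

section Ferromagnet

variable {J : ℤ → ℝ} {β : ℝ} {Λ : Finset ℤ} {i j : ℤ}

lemma bondCoupling_nonneg (hJ : 0 ≤ J) (hβ : 0 ≤ β) (Λ : Finset ℤ) :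
    0 ≤ bondCoupling J β Λ := fun e => by
  unfold bondCoupling
  split_ifs
  exacts [mul_nonneg hβ (hJ _), le_rfl]

lemma finiteCorrelation_nonneg (hJ : 0 ≤ J) (hβ : 0 ≤ β) (Λ : Finset ℤ) (i j : ℤ) :
    0 ≤ finiteCorrelation J β Λ i j := by
  by_cases h : i ∈ Λ ∧ j ∈ Λ
  · exact (charMean_nonneg (bondCoupling_nonneg hJ hβ Λ) _).trans_eq
      (finiteCorrelation_eq_charMean J β ⟨i, h.1⟩ ⟨j, h.2⟩).symm
  · rw [finiteCorrelation, dif_neg h]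

/-- The restriction of configurations to a smaller volume, as a group homomorphism. -/
def restrictConfig {Λ Λ' : Finset ℤ} (h : Λ ⊆ Λ') : Config Λ' →* Config Λ :=
  MonoidHom.pi fun i => Pi.evalMonoidHom _ (Set.inclusion h i)

lemma restrictConfig_surjective {Λ Λ' : Finset ℤ} (h : Λ ⊆ Λ') :
    Function.Surjective (restrictConfig h) :=
  (Set.inclusion_injective h).surjective_comp_right

lemma finiteCorrelation_mono (hJ : 0 ≤ J) (hβ : 0 ≤ β) (i j : ℤ) :
    Monotone fun Λ => finiteCorrelation J β Λ i j := fun Λ Λ' hΛ => by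
  by_cases h : i ∈ Λ ∧ j ∈ Λ
  swap
  · exact (dif_neg h).trans_le (finiteCorrelation_nonneg hJ hβ Λ' i j)
  have hinj := (Set.inclusion_injective hΛ).prodMap (Set.inclusion_injective hΛ)
  calc finiteCorrelation J β Λ i j
      = charMean bondChar (bondCoupling J β Λ) (spinChar ⟨i, h.1⟩ * spinChar ⟨j, h.2⟩) :=
        finiteCorrelation_eq_charMean J β ⟨i, h.1⟩ ⟨j, h.2⟩
    _ = charMean (bondChar ∘ Prod.map (Set.inclusion hΛ) (Set.inclusion hΛ)) (bondCoupling J β Λ)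
          (spinChar ⟨i, hΛ h.1⟩ * spinChar ⟨j, hΛ h.2⟩) :=
        (charMean_comp_of_surjective (restrictConfig_surjective hΛ) _ _ _).symm
    _ ≤ charMean bondChar (bondCoupling J β Λ') (spinChar ⟨i, hΛ h.1⟩ * spinChar ⟨j, hΛ h.2⟩) :=
        charMean_comp_le hinj (bondCoupling_nonneg hJ hβ Λ') _
    _ = finiteCorrelation J β Λ' i j :=
        (finiteCorrelation_eq_charMean J β ⟨i, hΛ h.1⟩ ⟨j, hΛ h.2⟩).symm

lemma tendsto_pairCorrelation (hJ : 0 ≤ J) (hβ : 0 ≤ β) (x : ℤ) :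
    Filter.Tendsto (fun Λ => finiteCorrelation J β Λ 0 x) Filter.atTop
      (𝓝 (pairCorrelation J β x)) := by
  have h := tendsto_atTop_ciSup (finiteCorrelation_mono hJ hβ 0 x)
    ⟨1, Set.forall_mem_range.2 fun Λ => finiteCorrelation_le_one J β Λ 0 x⟩
  rwa [pairCorrelation, h.limUnder_eq]

lemma bondCoupling_orderedBond (hJeven : ∀ y, J (-y) = J y) (β : ℝ) {i y : Λ} (h : i ≠ y) :
    bondCoupling J β Λ (orderedBond i y) = β * J (y - i) := by
  rw [bondCoupling, orderedBond, if_pos (min_lt_max.2 h)]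
  rcases le_total i y with hiy | hiy
  · simp [hiy]
  · simp [hiy, ← hJeven (y - i)]

lemma tanh_le_finiteCorrelation (hJ : 0 ≤ J) (hJeven : ∀ y, J (-y) = J y) (hβ : 0 ≤ β)
    (hi : i ∈ Λ) (hj : j ∈ Λ) (hij : i ≠ j) :
    Real.tanh (β * J (j - i)) ≤ finiteCorrelation J β Λ i j := by
  have h := tanh_le_charMean (c := bondChar) (bondCoupling_nonneg hJ hβ Λ)
    (orderedBond ⟨i, hi⟩ ⟨j, hj⟩)
  rwa [bondCoupling_orderedBond hJeven β fun h => hij (congrArg Subtype.val h),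
    bondChar_orderedBond, ← finiteCorrelation_eq_charMean] at h

lemma finiteCorrelation_le_sum (hJ : 0 ≤ J) (hJeven : ∀ y, J (-y) = J y) (hβ : 0 ≤ β)
    (hi : i ∈ Λ) (hj : j ∈ Λ) (hij : i ≠ j) :
    finiteCorrelation J β Λ i j ≤
      ∑ y ∈ Λ.erase i, β * J (y - i) * finiteCorrelation J β Λ y j := by
  lift i to Λ using hi
  lift j to Λ using hj
  have hflip : (spinChar i * spinChar j) (Pi.mulSingle i (-1)) = -1 := by
    simpa using spinChar_mul_spinChar_mulSingle (Subtype.coe_ne_coe.1 hij) (-1)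
  have hchar (y : Λ) : spinChar i * spinChar j * bondChar (orderedBond i y) =
      spinChar y * spinChar j := by
    rw [bondChar_orderedBond, mul_mul_mul_comm, character_mul_self, one_mul, mul_comm]
  calc finiteCorrelation J β Λ i j
      ≤ ∑ e with bondChar e (Pi.mulSingle i (-1)) = -1, bondCoupling J β Λ e *
          charMean bondChar (bondCoupling J β Λ) (spinChar i * spinChar j * bondChar e) :=
        (finiteCorrelation_eq_charMean J β i j).trans_le
          (charMean_le_sum_of_flip (bondCoupling_nonneg hJ hβ Λ) hflip)
    _ = ∑ y ∈ univ.erase i, β * J (y - i) * finiteCorrelation J β Λ y j := by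
        rw [sum_bondCoupling_mul_of_flip]
        refine sum_congr rfl fun y hy => ?_
        rw [bondCoupling_orderedBond hJeven β (ne_of_mem_erase hy).symm, hchar,
          finiteCorrelation_eq_charMean]
    _ = ∑ y ∈ Λ.erase ↑i, β * J (y - i) * finiteCorrelation J β Λ y j := by
        rw [sum_erase_eq_sub (mem_univ i), sum_erase_eq_sub i.2,
          sum_coe_sort Λ fun y => β * J (y - i) * finiteCorrelation J β Λ y j]

end Ferromagnet

section HighTemperature

variable {J : ℤ → ℝ} {β C M : ℝ} {Λ : Finset ℤ} {i j : ℤ}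

/-- The coupling `J` dominates its own convolution square, up to the factor `C`. Only the sums over
finite sets `T` of intermediate sites are bounded, so that no summability is needed, and `T` avoids
the end points, so that the value `J 0` plays no role. -/
def DominatesConvolution (J : ℤ → ℝ) (C : ℝ) : Prop :=
  ∀ ⦃i j : ℤ⦄, i ≠ j → ∀ T : Finset ℤ, i ∉ T → j ∉ T →
    ∑ y ∈ T, J (y - i) * J (j - y) ≤ C * J (j - i)

lemma finiteCorrelation_le_of_forall_le (hJ : 0 ≤ J) (hJeven : ∀ y, J (-y) = J y)
    (hC : DominatesConvolution J C) (hβ : 0 ≤ β) (hj : j ∈ Λ) (hM₀ : 0 ≤ M)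
    (hM : ∀ y ∈ Λ.erase j, finiteCorrelation J β Λ y j ≤ M * J (j - y)) (hi : i ∈ Λ)
    (hij : i ≠ j) : finiteCorrelation J β Λ i j ≤ β * (1 + C * M) * J (j - i) :=
  calc finiteCorrelation J β Λ i j
      ≤ ∑ y ∈ Λ.erase i, β * J (y - i) * finiteCorrelation J β Λ y j :=
        finiteCorrelation_le_sum hJ hJeven hβ hi hj hij
    _ = β * J (j - i) + ∑ y ∈ (Λ.erase i).erase j, β * J (y - i) * finiteCorrelation J β Λ y j := by
        rw [← add_sum_erase _ _ (mem_erase.2 ⟨hij.symm, hj⟩), finiteCorrelation_self J β hj,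
          mul_one]
    _ ≤ β * J (j - i) + ∑ y ∈ (Λ.erase i).erase j, β * J (y - i) * (M * J (j - y)) := by
        gcongr with y hy
        · exact mul_nonneg hβ (hJ _)
        · exact hM y (erase_subset_erase j (erase_subset i Λ) hy)
    _ = β * J (j - i) + β * M * ∑ y ∈ (Λ.erase i).erase j, J (y - i) * J (j - y) := by
        rw [mul_sum]
        exact congrArg _ (sum_congr rfl fun y _ => by ring)
    _ ≤ β * J (j - i) + β * M * (C * J (j - i)) := by
        gcongr
        exact hC hij _ (fun h => notMem_erase i Λ (mem_of_mem_erase h)) (notMem_erase j _)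
    _ = β * (1 + C * M) * J (j - i) := by ring

lemma finiteCorrelation_le (hJ : 0 ≤ J) (hJeven : ∀ y, J (-y) = J y) (hJpos : ∀ y ≠ 0, 0 < J y)
    (hC : DominatesConvolution J C) (hβ : 0 ≤ β) (hβC : β * C < 1) (hi : i ∈ Λ) (hj : j ∈ Λ)
    (hij : i ≠ j) : finiteCorrelation J β Λ i j ≤ β / (1 - β * C) * J (j - i) := by
  have hpos {y : ℤ} (hy : y ≠ j) : 0 < J (j - y) := hJpos _ (sub_ne_zero.2 hy.symm)
  obtain ⟨k, hk, hmax⟩ := (Λ.erase j).exists_max_image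
    (fun y => finiteCorrelation J β Λ y j / J (j - y)) ⟨i, mem_erase.2 ⟨hij, hi⟩⟩
  obtain ⟨hkj, hkΛ⟩ := mem_erase.1 hk
  set M := finiteCorrelation J β Λ k j / J (j - k) with hMdef
  have hM₀ : 0 ≤ M := div_nonneg (finiteCorrelation_nonneg hJ hβ Λ k j) (hJ _)
  have hM (y : ℤ) (hy : y ∈ Λ.erase j) : finiteCorrelation J β Λ y j ≤ M * J (j - y) :=
    (div_le_iff₀ (hpos (ne_of_mem_erase hy))).1 (hmax y hy)
  have hself : M ≤ β * (1 + C * M) := by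
    rw [hMdef, div_le_iff₀ (hpos hkj)]
    exact finiteCorrelation_le_of_forall_le hJ hJeven hC hβ hj hM₀ hM hkΛ hkj
  have hMle : M ≤ β / (1 - β * C) := by
    rw [le_div_iff₀ (sub_pos.2 hβC)]
    linarith
  exact (hM i (mem_erase.2 ⟨hij, hi⟩)).trans (mul_le_mul_of_nonneg_right hMle (hJ _))

lemma eventually_mem_and_mem (x y : ℤ) :
    ∀ᶠ Λ : Finset ℤ in Filter.atTop, x ∈ Λ ∧ y ∈ Λ :=
  (Filter.eventually_ge_atTop {x, y}).mono fun Λ hΛ => ⟨hΛ (by simp), hΛ (by simp)⟩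

lemma pairCorrelation_le (hJ : 0 ≤ J) (hJeven : ∀ y, J (-y) = J y) (hJpos : ∀ y ≠ 0, 0 < J y)
    (hC : DominatesConvolution J C) (hβ : 0 ≤ β) (hβC : β * C < 1) {x : ℤ} (hx : x ≠ 0) :
    pairCorrelation J β x ≤ β / (1 - β * C) * J x := by
  refine le_of_tendsto (tendsto_pairCorrelation hJ hβ x)
    ((eventually_mem_and_mem 0 x).mono fun Λ ⟨h0, hxΛ⟩ => ?_)
  simpa only [sub_zero] using finiteCorrelation_le hJ hJeven hJpos hC hβ hβC h0 hxΛ hx.symm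

lemma tanh_le_pairCorrelation (hJ : 0 ≤ J) (hJeven : ∀ y, J (-y) = J y) (hβ : 0 ≤ β) {x : ℤ}
    (hx : x ≠ 0) : Real.tanh (β * J x) ≤ pairCorrelation J β x := by
  refine ge_of_tendsto (tendsto_pairCorrelation hJ hβ x)
    ((eventually_mem_and_mem 0 x).mono fun Λ ⟨h0, hxΛ⟩ => ?_)
  simpa only [sub_zero] using tanh_le_finiteCorrelation hJ hJeven hβ h0 hxΛ hx.symm

lemma exists_pairCorrelation_bounds (hJ : 0 ≤ J) (hJeven : ∀ y, J (-y) = J y)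
    (hJpos : ∀ y ≠ 0, 0 < J y) (hJM : ∀ y ≠ 0, J y ≤ M) (hC : DominatesConvolution J C)
    (hβ : 0 < β) (hβC : β * C < 1) :
    ∃ c : ℝ, 0 < c ∧ ∀ x : ℤ, x ≠ 0 →
      c⁻¹ * J x ≤ pairCorrelation J β x ∧ pairCorrelation J β x ≤ c * J x := by
  have hupper : 0 < β / (1 - β * C) := div_pos hβ (sub_pos.2 hβC)
  have hlower : 0 < β / Real.cosh (β * M) := div_pos hβ (Real.cosh_pos _)
  set c := max (β / (1 - β * C)) (β / Real.cosh (β * M))⁻¹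
  refine ⟨c, lt_max_of_lt_left hupper, fun x hx => ⟨?_, ?_⟩⟩
  · calc c⁻¹ * J x ≤ β / Real.cosh (β * M) * J x :=
          mul_le_mul_of_nonneg_right (inv_le_of_inv_le₀ hlower (le_max_right _ _)) (hJ x)
      _ = β * J x / Real.cosh (β * M) := div_mul_eq_mul_div _ _ _
      _ ≤ Real.tanh (β * J x) :=
          div_cosh_le_tanh (mul_nonneg hβ.le (hJ x)) (mul_le_mul_of_nonneg_left (hJM x hx) hβ.le)
      _ ≤ pairCorrelation J β x := tanh_le_pairCorrelation hJ hJeven hβ.le hx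
  · exact (pairCorrelation_le hJ hJeven hJpos hC hβ.le hβC hx).trans
      (mul_le_mul_of_nonneg_right (le_max_left _ _) (hJ x))

end HighTemperature

end Ising

section ExpCoupling

variable {p : Seminorm ℝ ℝ} {α : ℝ}

lemma seminorm_real_apply (p : Seminorm ℝ ℝ) (t : ℝ) : p t = |t| * p 1 := by
  simpa using map_smul_eq_mul p t 1

lemma seminorm_intCast_pos (hp1 : 0 < p 1) {y : ℤ} (hy : y ≠ 0) : 0 < p y := by
  rw [seminorm_real_apply]
  exact mul_pos (abs_pos.2 (Int.cast_ne_zero.2 hy)) hp1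

lemma seminorm_one_le_intCast (p : Seminorm ℝ ℝ) {y : ℤ} (hy : y ≠ 0) : p 1 ≤ p y := by
  rw [seminorm_real_apply p y]
  exact le_mul_of_one_le_left (apply_nonneg p 1) (mod_cast Int.one_le_abs hy)

lemma exponent_neg_of_summable (hp1 : 0 < p 1)
    (hα : Summable fun y : {y : ℤ // y ≠ 0} => p (y : ℤ) ^ α) : α < 0 := by
  by_contra! h
  have : Infinite {y : ℤ // y ≠ 0} := (Set.finite_singleton 0).infinite_compl.to_subtype
  refine (Real.rpow_pos_of_pos hp1 α).not_ge (ge_of_tendsto' hα.tendsto_cofinite_zero fun y => ?_)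
  exact Real.rpow_le_rpow hp1.le (seminorm_one_le_intCast p y.2) h

lemma expCoupling_nonneg (p : Seminorm ℝ ℝ) (α : ℝ) : 0 ≤ expCoupling p α := fun _ =>
  mul_nonneg (Real.rpow_nonneg (apply_nonneg p _) α) (Real.exp_pos _).le

lemma expCoupling_neg (p : Seminorm ℝ ℝ) (α : ℝ) (y : ℤ) :
    expCoupling p α (-y) = expCoupling p α y := by
  rw [expCoupling, expCoupling, Int.cast_neg, map_neg_eq_map]

lemma expCoupling_pos (hp1 : 0 < p 1) (α : ℝ) {y : ℤ} (hy : y ≠ 0) : 0 < expCoupling p α y :=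
  mul_pos (Real.rpow_pos_of_pos (seminorm_intCast_pos hp1 hy) α) (Real.exp_pos _)

lemma expCoupling_le (hp1 : 0 < p 1) (hα : α ≤ 0) {y : ℤ} (hy : y ≠ 0) :
    expCoupling p α y ≤ p 1 ^ α :=
  calc expCoupling p α y ≤ p 1 ^ α * 1 :=
        mul_le_mul (Real.rpow_le_rpow_of_nonpos hp1 (seminorm_one_le_intCast p hy) hα)
          (Real.exp_le_one_iff.2 (neg_nonpos.2 (apply_nonneg p _))) (Real.exp_pos _).le
          (Real.rpow_nonneg hp1.le α)
    _ = p 1 ^ α := mul_one _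

-- The larger one of `u` and `v` is at least `w / 2`.
lemma rpow_mul_rpow_le {u v w : ℝ} (hu : 0 < u) (hv : 0 < v) (hw : 0 < w) (huv : w ≤ u + v)
    (hα : α ≤ 0) : u ^ α * v ^ α ≤ (w / 2) ^ α * (u ^ α + v ^ α) := by
  wlog h : u ≤ v generalizing u v
  · rw [mul_comm, add_comm]
    exact this hv hu (by rwa [add_comm]) (le_of_not_ge h)
  calc u ^ α * v ^ α ≤ u ^ α * (w / 2) ^ α := by
        gcongr ?_ * ?_
        exact Real.rpow_le_rpow_of_nonpos (half_pos hw) (by linarith) hα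
    _ ≤ (w / 2) ^ α * (u ^ α + v ^ α) := by
        rw [mul_comm]
        gcongr
        exact le_add_of_nonneg_right (by positivity)

lemma expCoupling_mul_expCoupling_le (hp1 : 0 < p 1) (hα : α ≤ 0) {a b : ℤ} (ha : a ≠ 0)
    (hb : b ≠ 0) (hab : a + b ≠ 0) :
    expCoupling p α a * expCoupling p α b ≤
      (1 / 2) ^ α * expCoupling p α (a + b) * (p a ^ α + p b ^ α) := by
  have htri : p (a + b : ℤ) ≤ p a + p b := by
    rw [Int.cast_add]
    exact map_add_le_add p _ _
  have hpow := rpow_mul_rpow_le (seminorm_intCast_pos hp1 ha) (seminorm_intCast_pos hp1 hb)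
    (seminorm_intCast_pos hp1 hab) htri hα
  have hexp : Real.exp (-p a) * Real.exp (-p b) ≤ Real.exp (-p (a + b : ℤ)) := by
    rw [← Real.exp_add, Real.exp_le_exp]
    linarith
  calc expCoupling p α a * expCoupling p α b
      = p a ^ α * p b ^ α * (Real.exp (-p a) * Real.exp (-p b)) := mul_mul_mul_comm _ _ _ _
    _ ≤ (p (a + b : ℤ) / 2) ^ α * (p a ^ α + p b ^ α) * Real.exp (-p (a + b : ℤ)) := by
        gcongr
    _ = (1 / 2) ^ α * expCoupling p α (a + b) * (p a ^ α + p b ^ α) := by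
        rw [div_eq_mul_one_div, Real.mul_rpow (apply_nonneg p _) (by norm_num), expCoupling]
        ring

lemma sum_comp_le_tsum_subtype {ι κ : Type*} {f : κ → ℝ} (hf : 0 ≤ f) {P : κ → Prop}
    (hsum : Summable fun y : Subtype P => f y) {T : Finset ι} {φ : ι → κ}
    (hφ : Function.Injective φ) (hT : ∀ x ∈ T, P (φ x)) :
    ∑ x ∈ T, f (φ x) ≤ ∑' y : Subtype P, f y := by
  let φ' (x : T) : Subtype P := ⟨φ x, hT x x.2⟩
  have hφ' : Function.Injective φ' := fun x y h => Subtype.ext (hφ (congrArg Subtype.val h))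
  rw [← T.tsum_subtype fun x => f (φ x)]
  exact tsum_comp_le_tsum_of_inj hsum (fun y => hf y) hφ'

lemma exists_dominatesConvolution_expCoupling (hp1 : 0 < p 1)
    (hα : Summable fun y : {y : ℤ // y ≠ 0} => p (y : ℤ) ^ α) :
    ∃ C > 0, Ising.DominatesConvolution (expCoupling p α) C := by
  have hα0 := (exponent_neg_of_summable hp1 hα).le
  have hnonneg (y : ℤ) : 0 ≤ p y ^ α := Real.rpow_nonneg (apply_nonneg p _) α
  set S := ∑' y : {y : ℤ // y ≠ 0}, p (y : ℤ) ^ α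
  have hS : 0 < S := hα.tsum_pos (fun y => hnonneg y) ⟨1, one_ne_zero⟩
    (Real.rpow_pos_of_pos (seminorm_intCast_pos hp1 one_ne_zero) α)
  refine ⟨2 * (1 / 2) ^ α * S, by positivity, fun i j hij T hi hj => ?_⟩
  have hyi {y : ℤ} (hy : y ∈ T) : y - i ≠ 0 := sub_ne_zero.2 (ne_of_mem_of_not_mem hy hi)
  have hjy {y : ℤ} (hy : y ∈ T) : j - y ≠ 0 := sub_ne_zero.2 (ne_of_mem_of_not_mem hy hj).symm
  have hpos := expCoupling_pos hp1 α (sub_ne_zero.2 hij.symm)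
  calc ∑ y ∈ T, expCoupling p α (y - i) * expCoupling p α (j - y)
      ≤ ∑ y ∈ T, (1 / 2) ^ α * expCoupling p α (j - i) *
          (p (y - i : ℤ) ^ α + p (j - y : ℤ) ^ α) := Finset.sum_le_sum fun y hy => by
        have hadd : y - i + (j - y) = j - i := by ring
        rw [← hadd]
        exact expCoupling_mul_expCoupling_le hp1 hα0 (hyi hy) (hjy hy)
          (hadd ▸ sub_ne_zero.2 hij.symm)
    _ = (1 / 2) ^ α * expCoupling p α (j - i) *
          (∑ y ∈ T, p (y - i : ℤ) ^ α + ∑ y ∈ T, p (j - y : ℤ) ^ α) := by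
        rw [← Finset.mul_sum, Finset.sum_add_distrib]
    _ ≤ (1 / 2) ^ α * expCoupling p α (j - i) * (S + S) := by
        gcongr
        · exact sum_comp_le_tsum_subtype hnonneg hα sub_left_injective fun y => hyi
        · exact sum_comp_le_tsum_subtype hnonneg hα sub_right_injective fun y => hjy
    _ = 2 * (1 / 2) ^ α * S * expCoupling p α (j - i) := by ring

end ExpCoupling

section OrnsteinZernike

open Filter Asymptotics

lemma not_isTheta_rpow_exp {ι : Type*} {l : Filter ι} [l.NeBot] {u : ι → ℝ}
    (hu : Tendsto u l atTop) {α : ℝ} (hα : α < 0) (k : ℝ) :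
    ¬ (fun n => u n ^ α) =Θ[l] fun n => Real.exp (k * u n) := by
  intro h
  rcases le_or_gt 0 k with hk | hk
  · have hpow : Tendsto (fun n => u n ^ α) l (𝓝 0) := by
      simpa only [neg_neg, Function.comp_def] using (tendsto_rpow_neg_atTop (neg_pos.2 hα)).comp hu
    have hexp : ∀ᶠ n in l, 1 ≤ Real.exp (k * u n) :=
      (hu.eventually_ge_atTop 0).mono fun n hn => Real.one_le_exp (mul_nonneg hk hn)
    have hlt : ∀ᶠ n in l, Real.exp (k * u n) < 1 :=
      (h.isBigO_symm.trans_tendsto hpow).eventually_lt_const one_pos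
    obtain ⟨n, hn, hn'⟩ := (hexp.and hlt).exists
    exact hn.not_gt hn'
  · have hlittle : (fun n => Real.exp (k * u n)) =o[l] fun n => u n ^ α := by
      simpa only [neg_neg, Function.comp_def] using
        (isLittleO_exp_neg_mul_rpow_atTop (neg_pos.2 hk) α).comp_tendsto hu
    refine hlittle.not_isBigO ?_ h.isBigO
    exact (Eventually.of_forall fun n => (Real.exp_pos (k * u n)).ne').frequently

variable {p : Seminorm ℝ ℝ} {α : ℝ} {G : ℤ → ℝ}

lemma expCoupling_units_mul (p : Seminorm ℝ ℝ) (α : ℝ) (s : ℤˣ) (n : ℕ) :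
    expCoupling p α (s * n) = (n * p 1) ^ α * Real.exp (-(n * p 1)) := by
  have hn : p ((s * n : ℤ) : ℝ) = n * p 1 := by
    rw [seminorm_real_apply]
    rcases Int.units_eq_one_or s with rfl | rfl <;> simp
  rw [expCoupling, hn]

lemma isTheta_of_forall_bounds {J : ℤ → ℝ} (hJ : 0 ≤ J) {c : ℝ} (hc : 0 < c)
    (h : ∀ x : ℤ, x ≠ 0 → c⁻¹ * J x ≤ G x ∧ G x ≤ c * J x) : G =Θ[cofinite] J := by
  have hne : ∀ᶠ x : ℤ in cofinite, x ≠ 0 := eventually_cofinite_ne 0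
  have hG {x : ℤ} (hx : x ≠ 0) : 0 ≤ G x :=
    (mul_nonneg (inv_nonneg.2 hc.le) (hJ x)).trans (h x hx).1
  refine ⟨.of_bound c (hne.mono fun x hx => ?_), .of_bound c (hne.mono fun x hx => ?_)⟩
  · rw [Real.norm_of_nonneg (hG hx), Real.norm_of_nonneg (hJ x)]
    exact (h x hx).2
  · rw [Real.norm_of_nonneg (hG hx), Real.norm_of_nonneg (hJ x)]
    exact (inv_mul_le_iff₀ hc).1 (h x hx).1

lemma not_hasOrnsteinZernikeAsymptotics_of_isTheta (hp1 : 0 < p 1) (hα : α < 0)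
    (hG : G =Θ[cofinite] expCoupling p α) (s : ℤˣ) : ¬ HasOrnsteinZernikeAsymptotics G s := by
  rintro ⟨A, hA, ν, -, h⟩
  have hu : Tendsto (fun n : ℕ => n * p 1) atTop atTop :=
    tendsto_natCast_atTop_atTop.atTop_mul_const hp1
  have hs : Tendsto (fun n : ℕ => (s * n : ℤ)) atTop cofinite := by
    rw [← Nat.cofinite_eq_atTop]
    exact ((mul_right_injective₀ s.ne_zero).comp Nat.cast_injective).tendsto_cofinite
  have hGs : (fun n : ℕ => G (s * n)) =Θ[atTop] fun n : ℕ => expCoupling p α (s * n) :=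
    ⟨hG.1.comp_tendsto hs, hG.2.comp_tendsto hs⟩
  have hθ : (fun n : ℕ => expCoupling p α (s * n)) =Θ[atTop] fun n : ℕ => Real.exp (-ν * n) :=
    hGs.symm.trans ((isTheta_const_mul_right hA.ne').1 h.isTheta)
  have hk (n : ℕ) : Real.exp (-ν * n) * Real.exp (n * p 1) =
      Real.exp ((1 - ν / p 1) * (n * p 1)) := by
    rw [← Real.exp_add]
    congr 1
    field_simp
    ring
  refine not_isTheta_rpow_exp hu hα (1 - ν / p 1) ?_
  simpa only [expCoupling_units_mul, mul_assoc, ← Real.exp_add, neg_add_cancel, Real.exp_zero,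
    mul_one, hk] using hθ.mul (isTheta_refl (fun n : ℕ => Real.exp (n * p 1)) atTop)

end OrnsteinZernike

theorem mainTheorem2 (p : Seminorm ℝ ℝ) (hp : ∀ t : ℝ, p t = 0 → t = 0) (α : ℝ)
    (hα : Summable (fun y : {y : ℤ // y ≠ 0} => (p ((y : ℤ) : ℝ)) ^ α)) :
    ∃ β₀ : ℝ, 0 < β₀ ∧ ∀ β : ℝ, 0 < β → β < β₀ →
      (∀ x : ℤ, Filter.Tendsto
        (fun Λ : Finset ℤ => Ising.finiteCorrelation (expCoupling p α) β Λ 0 x)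
        Filter.atTop (𝓝 (Ising.pairCorrelation (expCoupling p α) β x))) ∧
      (∃ c : ℝ, 0 < c ∧ ∀ x : ℤ, x ≠ 0 →
        c⁻¹ * ((p (x : ℝ)) ^ α * Real.exp (-p (x : ℝ)))
            ≤ Ising.pairCorrelation (expCoupling p α) β x ∧
        Ising.pairCorrelation (expCoupling p α) β x
            ≤ c * ((p (x : ℝ)) ^ α * Real.exp (-p (x : ℝ)))) ∧
      (∀ s : ℤˣ, ¬ HasOrnsteinZernikeAsymptotics
        (Ising.pairCorrelation (expCoupling p α) β) s) := by
  have hp1 : 0 < p 1 := (apply_nonneg p 1).lt_of_ne' (mt (hp 1) one_ne_zero)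
  have hα0 : α < 0 := exponent_neg_of_summable hp1 hα
  have hJ := expCoupling_nonneg p α
  obtain ⟨C, hC0, hC⟩ := exists_dominatesConvolution_expCoupling hp1 hα
  refine ⟨C⁻¹, inv_pos.2 hC0, fun β hβ hβC => ?_⟩
  obtain ⟨c, hc, hbounds⟩ := Ising.exists_pairCorrelation_bounds hJ (expCoupling_neg p α)
    (fun y => expCoupling_pos hp1 α) (fun y => expCoupling_le hp1 hα0.le) hC hβ
    (by rwa [← lt_div_iff₀ hC0, one_div])
  exact ⟨Ising.tendsto_pairCorrelation hJ hβ.le, ⟨c, hc, hbounds⟩,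
    not_hasOrnsteinZernikeAsymptotics_of_isTheta hp1 hα0 (isTheta_of_forall_bounds hJ hc hbounds)⟩
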